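/- Let $i \colon \mathbf{FinSet} \hookrightarrow \mathbf{Set}$ be the inclusion of the full subcategory of finite sets, and let $\mathcal{P}^{\mathrm f}$ be the restriction to $\mathbf{FinSet}$ of the covariant powerset monad on $\mathbf{Set}$ (functions act by direct image, the unit is $x \mapsto \{x\}$, the multiplication is union). The right Kan extension of $i\mathcal{P}^{\mathrm f}$ along $i$ exists. For any such right Kan extension $(R, \varepsilon \colon R i \Rightarrow i\mathcal{P}^{\mathrm f})$, let $i_\#\mathcal{P}^{\mathrm f}$ be the pushforward monad on $\mathbf{Set}$: its underlying endofunctor is $R$, and its unit $\eta$ and multiplication $\mu$ are the unique natural transformations $1 \Rightarrow R$ and $RR \Rightarrow R$ with $\varepsilon \cdot \eta i = i\eta^{\mathcal{P}^{\mathrm f}}$ and $\varepsilon \cdot \mu i = i\mu^{\mathcal{P}^{\mathrm f}} \cdot \varepsilon \mathcal{P}^{\mathrm f} \cdot R\varepsilon$. Then the Eilenberg–Moore category $\mathbf{Set}^{i_\#\mathcal{P}^{\mathrm f}}$ is equivalent to the category of continuous lattices, by an equivalence that commutes, up to natural isomorphism, with the forgetful functors to $\mathbf{Set}$. Here a continuous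 lattice is a complete lattice $L$ in which every $x$ is the join of $\{y \mid y \ll x\}$, where $y \ll x$ means that every nonempty directed $D \subseteq L$ with $x \le \bigvee D$ has an element $d$ with $y \le d$; the morphisms are the maps that preserve joins of nonempty directed subsets and arbitrary meets (the empty meet included). -/

import Mathlib

open CategoryTheory

universe v₁ v₂ u₁ u₂ u

namespace PushforwardMonad

section Pushforward

variable {A : Type u₁} [Category.{v₁} A] {B : Type u₂} [Category.{v₂} B]

/-- The natural transformation
`G R R ⟶ T G R ⟶ T T G ⟶ T G` (in diagrammatic order of composition of functors) that defines the
multiplication of the pushforward of `T` along `G`; at `X` it is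
`R (R (G X)) ⟶ R (G (T X)) ⟶ G (T (T X)) ⟶ G (T X)`. -/
def mulAux (G : A ⥤ B) (T : Monad A) (R : B ⥤ B) (ε : G ⋙ R ⟶ T.toFunctor ⋙ G) :
    G ⋙ (R ⋙ R) ⟶ T.toFunctor ⋙ G where
  app X := R.map (ε.app X) ≫ ε.app (T.obj X) ≫ G.map (T.μ.app X)
  naturality X Y f := by
    have h1 := ε.naturality f
    have h2 := ε.naturality (T.map f)
    have h3 := T.μ.naturality f
    dsimp at h1 h2 h3 ⊢
    rw [← R.map_comp_assoc, h1, R.map_comp_assoc, reassoc_of% h2, ← G.map_comp, h3]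
    simp

/-- The natural transformation `G ⟶ T G` (diagrammatic order) with components `G (η X)`, that
defines the unit of the pushforward of `T` along `G`. -/
def unitAux (G : A ⥤ B) (T : Monad A) : G ⋙ 𝟭 B ⟶ T.toFunctor ⋙ G where
  app X := G.map (T.η.app X)
  naturality X Y f := by
    have h := T.η.naturality f
    dsimp at h ⊢
    rw [← G.map_comp, h, G.map_comp]

variable (G : A ⥤ B) (T : Monad A) (R : B ⥤ B) (ε : G ⋙ R ⟶ T.toFunctor ⋙ G)
  [R.IsRightKanExtension ε]

/-- The unit of the pushforward: the unique transformation `𝟭 ⟶ R` whose restriction along `G`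
followed by `ε` is `G η`. -/
noncomputable def pushforwardUnit : 𝟭 B ⟶ R :=
  R.liftOfIsRightKanExtension ε (𝟭 B) (unitAux G T)

/-- The multiplication of the pushforward: the unique transformation `R R ⟶ R` whose restriction
along `G` followed by `ε` is `mulAux`. -/
noncomputable def pushforwardMul : R ⋙ R ⟶ R :=
  R.liftOfIsRightKanExtension ε (R ⋙ R) (mulAux G T R ε)

lemma pushforwardUnit_fac (X : A) :
    (pushforwardUnit G T R ε).app (G.obj X) ≫ ε.app X = G.map (T.η.app X) :=
  R.liftOfIsRightKanExtension_fac_app ε (𝟭 B) (unitAux G T) X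

lemma pushforwardMul_fac (X : A) :
    (pushforwardMul G T R ε).app (G.obj X) ≫ ε.app X =
      R.map (ε.app X) ≫ ε.app (T.obj X) ≫ G.map (T.μ.app X) :=
  R.liftOfIsRightKanExtension_fac_app ε (R ⋙ R) (mulAux G T R ε) X

/-- The pushforward monad `G_# T` of a monad `T` on `A` along a functor `G : A ⥤ B`, computed from
a right Kan extension `(R, ε)` of `T ⋙ G` (the functor `X ↦ G (T X)`) along `G`: the underlying
endofunctor is `R`, and the unit and the multiplication come from the universal property. -/
noncomputable def pushforward : Monad B where
  toFunctor := R
  η := pushforwardUnit G T R ε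
  μ := pushforwardMul G T R ε
  left_unit X := by
    let γ : R ⟶ R := Functor.whiskerLeft R (pushforwardUnit G T R ε) ≫ pushforwardMul G T R ε
    have h : γ = 𝟙 R := by
      refine R.hom_ext_of_isRightKanExtension ε _ _ ?_
      ext Y
      have h1 := (pushforwardUnit G T R ε).naturality (ε.app Y)
      dsimp [γ] at h1 ⊢
      rw [Category.assoc, pushforwardMul_fac, ← reassoc_of% h1,
        reassoc_of% (pushforwardUnit_fac G T R ε (T.obj Y)), ← G.map_comp, T.left_unit]
      simp
    exact NatTrans.congr_app h X
  right_unit X := by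
    let γ : R ⟶ R := Functor.whiskerRight (pushforwardUnit G T R ε) R ≫ pushforwardMul G T R ε
    have h : γ = 𝟙 R := by
      refine R.hom_ext_of_isRightKanExtension ε _ _ ?_
      ext Y
      have h1 := ε.naturality (T.η.app Y)
      dsimp [γ] at h1 ⊢
      rw [Category.assoc, pushforwardMul_fac, ← R.map_comp_assoc, pushforwardUnit_fac,
        reassoc_of% h1, ← G.map_comp, T.right_unit]
      simp
    exact NatTrans.congr_app h X
  assoc X := by
    let γ₁ : R ⋙ R ⋙ R ⟶ R :=
      Functor.whiskerRight (pushforwardMul G T R ε) R ≫ pushforwardMul G T R ε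
    let γ₂ : R ⋙ R ⋙ R ⟶ R :=
      Functor.whiskerLeft R (pushforwardMul G T R ε) ≫ pushforwardMul G T R ε
    have h : γ₁ = γ₂ := by
      refine R.hom_ext_of_isRightKanExtension ε _ _ ?_
      ext Y
      have h1 := ε.naturality (T.μ.app Y)
      have h2 := (pushforwardMul G T R ε).naturality (ε.app Y)
      dsimp [γ₁, γ₂] at h1 h2 ⊢
      rw [Category.assoc, Category.assoc, pushforwardMul_fac, ← R.map_comp_assoc,
        pushforwardMul_fac, ← reassoc_of% h2, reassoc_of% (pushforwardMul_fac G T R ε (T.obj Y))]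
      simp only [Functor.map_comp, Category.assoc]
      rw [reassoc_of% h1, ← G.map_comp, T.assoc, G.map_comp]
    exact NatTrans.congr_app h X

end Pushforward

section Restrict

variable {C : Type u₁} [Category.{v₁} C]

/-- The restriction of a monad to a full subcategory that its endofunctor preserves. -/
def restrictMonad (P : ObjectProperty C) (T : Monad C) (hT : ∀ X, P X → P (T.obj X)) :
    Monad P.FullSubcategory where
  obj X := ⟨T.obj X.obj, hT X.obj X.property⟩
  map f := ObjectProperty.homMk (T.map f.hom)
  η := { app := fun X => ObjectProperty.homMk (T.η.app X.obj)
         naturality := fun X Y f => by ext1; exact T.η.naturality f.hom }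
  μ := { app := fun X => ObjectProperty.homMk (T.μ.app X.obj)
         naturality := fun X Y f => by ext1; exact T.μ.naturality f.hom }
  assoc X := by ext1; exact T.assoc X.obj
  left_unit X := by ext1; exact T.left_unit X.obj
  right_unit X := by ext1; exact T.right_unit X.obj

end Restrict

/-- The covariant powerset monad on `Set`: functions act by direct image, the unit is
`x ↦ {x}`, and the multiplication is union. -/
def powersetMonad : Monad (Type u) where
  obj X := Set X
  map f := ↾(fun s : Set _ => f '' s)
  map_id X := ConcreteCategory.hom_ext _ _ fun s : Set X => Set.image_id s
  map_comp {X _ _} f g := ConcreteCategory.hom_ext _ _ fun s : Set X => Set.image_comp g f s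
  η := { app := fun X => ↾(fun x : X => ({x} : Set X))
         naturality := fun X Y f => ConcreteCategory.hom_ext _ _ fun x : X =>
          (Set.image_singleton (f := f) (a := x)).symm }
  μ := { app := fun X => ↾(fun S : Set (Set X) => ⋃₀ S)
         naturality := fun X Y f => ConcreteCategory.hom_ext _ _ fun S : Set (Set X) =>
          (Set.image_sUnion (f := f) (s := S)).symm }
  assoc X := ConcreteCategory.hom_ext _ _ fun S : Set (Set (Set X)) =>
    show ⋃₀ (Set.sUnion '' S) = ⋃₀ (⋃₀ S) by
      ext x
      simp only [Set.mem_sUnion, Set.mem_image, exists_exists_and_eq_and]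
      exact ⟨fun ⟨a, ha, b, hb, hx⟩ => ⟨b, ⟨a, ha, hb⟩, hx⟩,
        fun ⟨b, ⟨a, ha, hb⟩, hx⟩ => ⟨a, ha, b, hb, hx⟩⟩
  left_unit X := ConcreteCategory.hom_ext _ _ fun s : Set X => Set.sUnion_singleton s
  right_unit X := ConcreteCategory.hom_ext _ _ fun s : Set X =>
    show ⋃₀ ((fun x : X => ({x} : Set X)) '' s) = s by
      rw [Set.sUnion_image]; exact Set.biUnion_of_singleton s

/-- The powerset monad on the category of finite sets. -/
def finPowersetMonad : Monad FintypeCat.{u} :=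
  restrictMonad _ powersetMonad.{u} (fun X (_ : Finite X) => show Finite (Set X) from inferInstance)

section ContinuousLattice

/-- The way-below relation `y ≪ x` of a complete lattice: every nonempty directed set whose
supremum is above `x` has an element above `y`. -/
def WayBelow {L : Type u} [CompleteLattice L] (y x : L) : Prop :=
  ∀ D : Set L, D.Nonempty → DirectedOn (· ≤ ·) D → x ≤ sSup D → ∃ d ∈ D, y ≤ d

/-- A complete lattice is continuous if every element is the supremum of the elements way below
it. -/
class IsContinuousLattice (L : Type u) [CompleteLattice L] : Prop where
  sSup_wayBelow : ∀ x : L, sSup {y | WayBelow y x} = x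

/-- Maps of complete lattices that preserve arbitrary meets and (nonempty) directed joins. -/
structure DirSupInfHom (L M : Type u) [CompleteLattice L] [CompleteLattice M] extends
    sInfHom L M where
  scottContinuous' : ScottContinuous toFun

instance (L M : Type u) [CompleteLattice L] [CompleteLattice M] :
    FunLike (DirSupInfHom L M) L M where
  coe f := f.toFun
  coe_injective f g h := by
    obtain ⟨⟨f, hf⟩, hf'⟩ := f
    obtain ⟨⟨g, hg⟩, hg'⟩ := g
    congr

end ContinuousLattice

/-- The category of continuous lattices: its objects are the continuous lattices, its morphisms
the maps that preserve arbitrary meets and directed joins. -/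
structure ContinuousLat where
  /-- The underlying set. -/
  carrier : Type u
  [str : CompleteLattice carrier]
  [isContinuous : IsContinuousLattice carrier]

attribute [instance] ContinuousLat.str ContinuousLat.isContinuous

instance : LargeCategory.{u} ContinuousLat.{u} where
  Hom L M := DirSupInfHom L.carrier M.carrier
  id L := { sInfHom.id L.carrier with scottContinuous' := ScottContinuous.id }
  comp f g :=
    { g.tosInfHom.comp f.tosInfHom with
      scottContinuous' := ScottContinuous.comp (f := f.toFun) (g := g.toFun)
        f.scottContinuous' g.scottContinuous' }

instance : ConcreteCategory ContinuousLat.{u} (fun L M => DirSupInfHom L.carrier M.carrier) where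
  hom f := f
  ofHom f := f

end PushforwardMonad

/-! The pushforward is the filter monad, improper filters included. A transformation from `G` into
the finite powersets gives each `x : G X` a subset of every finite set that `X` maps to, compatibly
in the maps. Such a family is a filter on `X`: `U` belongs to it when the subset attached to the
characteristic map of `U` is contained in `{True}`. So the filter functor, with counit `Filter.ker`,
is the Kan extension, and `pushforwardIso` matches the monads.

Algebras of the filter monad are continuous lattices (Day, Wyler). Values at principal filters
supply the meets, and `IsLatticeAlgebra.eq_limsInf` shows that the lattice determines the whole
structure map, namely `limsInf`. Tail filters of directed sets then yield continuity. Conversely,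
continuity makes `limsInf` associative, and `map_limsInf_iff` identifies the homomorphisms. -/

namespace PushforwardMonad

open Filter Set

/-! ### Algebras of the filter monad as continuous lattices -/

section FilterAlgebra

variable {X : Type u} {a : Filter X → X}

/-- The laws of an Eilenberg–Moore algebra of the filter monad. -/
structure IsFilterAlgebra (a : Filter X → X) : Prop where
  map_pure : ∀ x, a (pure x) = x
  map_join : ∀ F : Filter (Filter X), a (map a F) = a (join F)

namespace IsFilterAlgebra

variable (h : IsFilterAlgebra a)
include h

lemma map_principal_singleton (x : X) : a (𝓟 {x}) = x := by
  rw [principal_singleton, h.map_pure]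

lemma map_sSup (S : Set (Filter X)) : a (sSup S) = a (𝓟 (a '' S)) := by
  rw [← join_principal_eq_sSup, ← h.map_join, map_principal]

lemma map_sup (F G : Filter X) : a (F ⊔ G) = a (𝓟 {a F, a G}) := by
  rw [← sSup_pair, h.map_sSup, image_pair]

lemma map_principal_sUnion (S : Set (Set X)) :
    a (𝓟 (⋃₀ S)) = a (𝓟 ((fun s => a (𝓟 s)) '' S)) := by
  have : 𝓟 (⋃₀ S) = sSup (𝓟 '' S) := by
    ext U
    simp [Filter.mem_sSup]
  rw [this, h.map_sSup, image_image]

lemma map_principal_union (s t : Set X) : a (𝓟 (s ∪ t)) = a (𝓟 {a (𝓟 s), a (𝓟 t)}) := by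
  rw [← sup_principal, h.map_sup]

lemma map_principal_insert (x : X) (s : Set X) :
    a (𝓟 (insert x s)) = a (𝓟 {x, a (𝓟 s)}) := by
  rw [insert_eq, h.map_principal_union, h.map_principal_singleton]

/-- The partial order of a filter algebra. -/
@[reducible] def partialOrder : PartialOrder X where
  le x y := a (𝓟 {x, y}) = x
  le_refl x := by
    rw [pair_eq_singleton, h.map_principal_singleton]
  le_trans x y z hxy hyz := by
    change a (𝓟 {x, y}) = x at hxy
    change a (𝓟 {y, z}) = y at hyz
    -- Transitivity compares two evaluations of `a (𝓟 {x, y, z})`, one for each bracketing.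
    have h1 := h.map_principal_insert x {y, z}
    rw [hyz, hxy] at h1
    have h2 := h.map_principal_union {x, y} {z}
    rw [hxy, h.map_principal_singleton, insert_union, singleton_union, h1] at h2
    exact h2.symm
  le_antisymm x y hxy hyx := by
    change a (𝓟 {x, y}) = x at hxy
    change a (𝓟 {y, x}) = y at hyx
    rw [← hxy, pair_comm, hyx]

/-- The complete lattice of a filter algebra: the meet of a set is the value at its principal
filter. -/
@[reducible] def completeLattice : CompleteLattice X :=
  letI := h.partialOrder
  letI : InfSet X := ⟨fun s => a (𝓟 s)⟩
  completeLatticeOfInf X fun s => by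
    constructor
    · intro x hx
      change a (𝓟 {a (𝓟 s), x}) = a (𝓟 s)
      rw [pair_comm, ← h.map_principal_insert, insert_eq_of_mem hx]
    · intro x hx
      change a (𝓟 {x, a (𝓟 s)}) = x
      -- The pieces `{x, y}` all have value `x`, and they cover `insert x s`. The extra piece `{x}`
      -- handles empty `s`.
      have h1 := h.map_principal_sUnion (insert {x} ((fun y => {x, y}) '' s))
      have h2 : ⋃₀ (insert {x} ((fun y => {x, y}) '' s)) = insert x s := by
        ext z
        simp only [mem_sUnion, mem_insert_iff, mem_image, exists_eq_or_imp, mem_singleton_iff,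
          exists_exists_and_eq_and]
        grind
      have h3 : (fun s => a (𝓟 s)) '' (insert {x} ((fun y => {x, y}) '' s)) = {x} := by
        rw [image_insert_eq, image_image, h.map_principal_singleton]
        refine subset_antisymm (insert_subset rfl ?_) (singleton_subset_iff.2 (mem_insert _ _))
        rintro _ ⟨y, hy, rfl⟩
        exact hx hy
      rw [h2, h3, h.map_principal_insert, h.map_principal_singleton] at h1
      exact h1

end IsFilterAlgebra

/-- A filter algebra whose lattice structure computes its values at principal filters. -/
structure IsLatticeAlgebra [CompleteLattice X] (a : Filter X → X) : Prop
    extends IsFilterAlgebra a where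
  map_principal : ∀ s, a (𝓟 s) = sInf s

namespace IsLatticeAlgebra
variable [CompleteLattice X] (h : IsLatticeAlgebra a)
include h

lemma map_sup (F G : Filter X) : a (F ⊔ G) = a F ⊓ a G := by
  rw [h.toIsFilterAlgebra.map_sup, h.map_principal, sInf_pair]

lemma antitone {F G : Filter X} (hFG : F ≤ G) : a G ≤ a F := by
  rw [← sup_eq_right.2 hFG, h.map_sup]
  exact inf_le_left

/-- Meeting with `y` is `a` applied to `𝓟 {x, y}`, and joining these filters along `F` gives `F ⊔
pure y`. Properness matters: `a ⊥ = ⊤`. -/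
lemma map_inf (F : Filter X) [NeBot F] (y : X) : a (map (· ⊓ y) F) = a F ⊓ y := by
  have h1 : (· ⊓ y) = a ∘ fun x => 𝓟 {x, y} := by
    funext x
    simp [h.map_principal]
  have h2 : join (map (fun x => 𝓟 {x, y}) F) = F ⊔ pure y := by
    ext U
    simp only [mem_join, mem_map, mem_sup, mem_pure]
    change (∀ᶠ x in F, {x, y} ⊆ U) ↔ _
    simp only [pair_subset_iff]
    rw [eventually_and, eventually_const]
    rfl
  rw [h1, ← Filter.map_map, h.map_join, h2, h.map_sup, h.map_pure]

/-- `F` is the join of the principal filters `𝓟 U` as `U` shrinks through the members of `F`. If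
every `sInf U` is below `y`, meeting with `y` changes nothing along the way, so by `map_inf` it does
not change `a F` either. -/
lemma le_of_forall {F : Filter X} {y : X} (hy : ∀ U ∈ F, sInf U ≤ y) : a F ≤ y := by
  have hb := F.basis_sets.smallSets.inf_principal F.sets
  have hne : NeBot (F.smallSets ⊓ 𝓟 F.sets) :=
    hb.neBot_iff.2 fun {U} hU => ⟨U, Subset.rfl, hU⟩
  have h1 : join (map 𝓟 (F.smallSets ⊓ 𝓟 F.sets)) = F := by
    ext U
    rw [mem_join, mem_map, hb.mem_iff]
    constructor
    · rintro ⟨V, hV, h⟩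
      exact mem_of_superset hV (h ⟨Subset.rfl, hV⟩)
    · intro hU
      exact ⟨U, hU, fun V hV => hV.1⟩
  have h2 : map (· ⊓ y) (map a (map 𝓟 (F.smallSets ⊓ 𝓟 F.sets))) =
      map a (map 𝓟 (F.smallSets ⊓ 𝓟 F.sets)) := by
    conv_rhs => rw [← map_id (f := map a _)]
    rw [Filter.map_map, Filter.map_map, Filter.map_map]
    refine Filter.map_congr ?_
    filter_upwards [mem_inf_of_right (mem_principal_self _)] with U hU
    simp [h.map_principal, hy U hU]
  have h3 := h.map_inf (map a (map 𝓟 (F.smallSets ⊓ 𝓟 F.sets))) y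
  rw [h2, h.map_join, h1] at h3
  exact left_eq_inf.1 h3

lemma eq_limsInf (F : Filter X) : a F = limsInf F := by
  refine le_antisymm (h.le_of_forall fun U hU => ?_) (sSup_le fun x hx => ?_)
  · exact le_sSup (mem_of_superset hU fun x hx => sInf_le hx)
  · have h1 : F ≤ 𝓟 (Ici x) := le_principal_iff.2 hx
    have := h.antitone h1
    rwa [h.map_principal, csInf_Ici] at this

end IsLatticeAlgebra

/-- The filter of tails of a directed set. -/
def tails {L : Type u} [Preorder L] (D : Set L) : Filter L := ⨅ d ∈ D, 𝓟 (D ∩ Ici d)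

lemma mem_tails {L : Type u} [Preorder L] {D : Set L} (hD : D.Nonempty)
    (hD' : DirectedOn (· ≤ ·) D) {U : Set L} : U ∈ tails D ↔ ∃ d ∈ D, D ∩ Ici d ⊆ U := by
  rw [tails, mem_biInf_of_directed _ hD]
  · simp
  · intro x hx y hy
    obtain ⟨z, hz, hxz, hyz⟩ := hD' x hx y hy
    refine ⟨z, hz, ?_, ?_⟩ <;> simp only [ge_iff_le, Order.Preimage, le_principal_iff, mem_principal]
    · exact inter_subset_inter_right _ (Ici_subset_Ici.2 hxz)
    · exact inter_subset_inter_right _ (Ici_subset_Ici.2 hyz)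

/-- A map carries the tails of a directed set to a filter whose lower limit is the join of the
image, if the map is monotone. -/
lemma limsInf_map_tails {L M : Type u} [CompleteLattice L] [CompleteLattice M] {f : L → M}
    (hf : Monotone f) {D : Set L} (hD : D.Nonempty) (hD' : DirectedOn (· ≤ ·) D) :
    limsInf (map f (tails D)) = sSup (f '' D) := by
  apply le_antisymm
  · refine sSup_le fun y hy => ?_
    obtain ⟨d, hd, h⟩ := (mem_tails hD hD').1 (mem_map.1 hy)
    exact le_sSup_of_le (mem_image_of_mem f hd) (h ⟨hd, self_mem_Ici⟩)
  · refine sSup_le ?_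
    rintro _ ⟨d, hd, rfl⟩
    refine le_sSup ?_
    exact (mem_tails hD hD').2 ⟨d, hd, fun x hx => hf hx.2⟩

lemma limsInf_tails {L : Type u} [CompleteLattice L] {D : Set L} (hD : D.Nonempty)
    (hD' : DirectedOn (· ≤ ·) D) : limsInf (tails D) = sSup D := by
  simpa using limsInf_map_tails monotone_id hD hD'

lemma IsLatticeAlgebra.isContinuousLattice [CompleteLattice X] (h : IsLatticeAlgebra a) :
    IsContinuousLattice X where
  sSup_wayBelow x := by
    apply le_antisymm
    · refine sSup_le fun y hy => ?_
      obtain ⟨d, rfl, hd⟩ := hy {x} (singleton_nonempty x) (directedOn_singleton _)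
        (by simp)
      exact hd
    -- Since `a` turns suprema of filters into meets, there is a largest filter with value at least
    -- `x`. It contains the tails of each directed `D` with `x ≤ sSup D`, so `Ici y` in it forces
    -- `y` to be way below `x`.
    · have h1 : x ≤ a (sSup {F | x ≤ a F}) := by
        rw [h.map_sSup, h.map_principal]
        refine le_sInf ?_
        rintro _ ⟨F, hF, rfl⟩
        exact hF
      rw [h.eq_limsInf] at h1
      refine h1.trans (sSup_le_sSup fun y hy D hD hD' hx => ?_)
      have h2 : tails D ≤ sSup {F | x ≤ a F} := le_sSup (by
        rw [mem_ofPred_eq, h.eq_limsInf, limsInf_tails hD hD']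
        exact hx)
      obtain ⟨d, hd, hdy⟩ := (mem_tails hD hD').1 (h2 hy)
      exact ⟨d, hd, hdy ⟨hd, self_mem_Ici⟩⟩

lemma directedOn_eventually_le {L : Type u} [CompleteLattice L] (F : Filter L) :
    DirectedOn (· ≤ ·) {y | ∀ᶠ x in F, y ≤ x} := fun y hy z hz =>
  ⟨y ⊔ z, by filter_upwards [hy, hz] with x h1 h2 using sup_le h1 h2, le_sup_left, le_sup_right⟩

lemma isLatticeAlgebra_limsInf (L : Type u) [CompleteLattice L] [IsContinuousLattice L] :
    IsLatticeAlgebra (limsInf : Filter L → L) where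
  map_pure x := by rw [← principal_singleton, limsInf_principal_eq_sInf, sInf_singleton]
  map_principal := limsInf_principal_eq_sInf
  map_join F := by
    apply le_antisymm
    · refine sSup_le fun z hz => ?_
      -- Only this inequality needs continuity: `y ≪ z ≤ limsInf G` puts `y` below an eventual lower
      -- bound of `G`.
      rw [← IsContinuousLattice.sSup_wayBelow z]
      refine sSup_le fun y hy => le_sSup ?_
      change ∀ᶠ G in F, ∀ᶠ x in G, y ≤ x
      filter_upwards [mem_map.1 hz] with G hG
      obtain ⟨w, hw, hyw⟩ := hy {y | ∀ᶠ x in G, y ≤ x} ⟨⊥, by simp⟩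
        (directedOn_eventually_le G) hG
      filter_upwards [hw] with x hx using hyw.trans hx
    · refine sSup_le fun z hz => le_sSup ?_
      change ∀ᶠ G in F, z ≤ limsInf G
      filter_upwards [mem_join.1 hz] with G hG using le_sSup hG

/-- The maps of continuous lattices are the maps that commute with lower limits. -/
lemma map_limsInf_iff {L M : Type u} [CompleteLattice L] [CompleteLattice M] (f : L → M) :
    (∀ F : Filter L, f (limsInf F) = limsInf (map f F)) ↔
      (∀ s, f (sInf s) = sInf (f '' s)) ∧ ScottContinuous f := by
  have mono (hf : ∀ s, f (sInf s) = sInf (f '' s)) : Monotone f := fun x y hxy => by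
    have := hf {x, y}
    rw [sInf_pair, inf_eq_left.2 hxy, image_pair, sInf_pair] at this
    exact left_eq_inf.1 this
  constructor
  · intro h
    have hf (s) : f (sInf s) = sInf (f '' s) := by
      simpa [limsInf_principal_eq_sInf] using h (𝓟 s)
    refine ⟨hf, fun D hD hD' x hx => ?_⟩
    have := h (tails D)
    rw [limsInf_tails hD hD', limsInf_map_tails (mono hf) hD hD'] at this
    rw [← hx.sSup_eq, this]
    exact isLUB_sSup _
  · rintro ⟨hf, hf'⟩ F
    refine (hf' ⟨⊥, by simp⟩ (directedOn_eventually_le F) (isLUB_sSup _)).unique ?_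
    constructor
    · rintro _ ⟨y, hy, rfl⟩
      refine le_sSup ?_
      filter_upwards [show ∀ᶠ x in F, y ≤ x from hy] with x hx using mono hf hx
    · intro z hz
      refine sSup_le fun w hw => ?_
      -- The witness is the left adjoint of `f` evaluated at `w`; it exists because `f` preserves
      -- meets.
      have h1 : w ≤ f (sInf (f ⁻¹' Ici w)) := by
        rw [hf]
        exact le_sInf (by rintro _ ⟨x, hx, rfl⟩; exact hx)
      refine h1.trans (hz ⟨_, ?_, rfl⟩)
      exact mem_of_superset (mem_map.1 hw) fun x hx => sInf_le hx

end FilterAlgebra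

/-! ### Uniqueness of the pushforward monad -/

section PushforwardIso

variable {A : Type u₁} [Category.{v₁} A] {B : Type u₂} [Category.{v₂} B]
  (G : A ⥤ B) (T : Monad A) (R : B ⥤ B) (ε : G ⋙ R ⟶ T.toFunctor ⋙ G)
  [R.IsRightKanExtension ε] (S : Monad B) (κ : G ⋙ S.toFunctor ⟶ T.toFunctor ⋙ G)
  [S.toFunctor.IsRightKanExtension κ]

/-- A monad whose underlying functor is a right Kan extension, with a counit that is compatible
with the unit and the multiplication, is the pushforward monad. -/
noncomputable def pushforwardIso
    (hη : ∀ X, S.η.app (G.obj X) ≫ κ.app X = G.map (T.η.app X))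
    (hμ : ∀ X, S.μ.app (G.obj X) ≫ κ.app X =
      S.map (κ.app X) ≫ κ.app (T.obj X) ≫ G.map (T.μ.app X)) :
    pushforward G T R ε ≅ S :=
  let α : R ≅ S.toFunctor := R.rightKanExtensionUnique ε S.toFunctor κ
  have hα (X : A) : α.hom.app (G.obj X) ≫ κ.app X = ε.app X := by simp [α]
  MonadIso.mk α
    (by
      have : pushforwardUnit G T R ε ≫ α.hom = S.η := by
        refine S.toFunctor.hom_ext_of_isRightKanExtension κ _ _ ?_
        ext X
        simp [hα, hη, pushforwardUnit_fac]
      exact fun X => NatTrans.congr_app this X)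
    (by
      have : pushforwardMul G T R ε ≫ α.hom =
          Functor.whiskerRight α.hom R ≫ Functor.whiskerLeft S.toFunctor α.hom ≫ S.μ := by
        refine S.toFunctor.hom_ext_of_isRightKanExtension κ _ _ ?_
        ext X
        have h1 := α.hom.naturality (κ.app X)
        dsimp at h1 ⊢
        rw [Category.assoc, Category.assoc, Category.assoc, hα, pushforwardMul_fac, hμ,
          ← reassoc_of% h1, ← R.map_comp_assoc, hα, reassoc_of% (hα (T.obj X))]
      intro X
      have := NatTrans.congr_app this X
      dsimp at this
      exact this.trans (Category.assoc _ _ _).symm)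

end PushforwardIso

/-! ### The filter monad as a pushforward -/

/-- The filter monad on `Type u`; improper filters are included. -/
def filterMonad : Monad (Type u) where
  obj X := Filter X
  map f := ↾(fun F : Filter _ => F.map f)
  η := { app := fun X => ↾(fun x : X => (pure x : Filter X)) }
  μ := { app := fun X => ↾(fun F : Filter (Filter X) => join F) }

/-- A filter on a finite set has finitely many members, so it contains their intersection and is
principal. -/
lemma mem_iff_ker_subset {A : Type u} [Finite A] {F : Filter A} {U : Set A} :
    U ∈ F ↔ F.ker ⊆ U := by
  refine ⟨fun h => sInter_subset_of_mem h, mem_of_superset ?_⟩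
  exact (sInter_mem F.sets.toFinite).2 fun _ h => h

/-- The counit of the filter functor as a right Kan extension: a filter on a finite set is sent to
the set that generates it. -/
def filterCounit : FintypeCat.incl.{u} ⋙ filterMonad.{u}.toFunctor ⟶
    finPowersetMonad.{u}.toFunctor ⋙ FintypeCat.incl.{u} where
  app A := ↾(fun F : Filter A.obj => F.ker)
  naturality A B f := ConcreteCategory.hom_ext _ _ fun F : Filter A.obj =>
    show (F.map f.hom).ker = f.hom '' F.ker by
      refine subset_antisymm ?_ ?_
      · rw [← mem_iff_ker_subset, mem_map, mem_iff_ker_subset]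
        exact subset_preimage_image _ _
      · rw [image_subset_iff, ← mem_iff_ker_subset, ← mem_map, mem_iff_ker_subset]

section Lift

variable {G : Type u ⥤ Type u}
  (γ : FintypeCat.incl.{u} ⋙ G ⟶ finPowersetMonad.{u}.toFunctor ⋙ FintypeCat.incl.{u})

/-- The value of `γ` at an element of `G X`, along a map to a finite set. -/
def valueAt {X : Type u} (x : G.obj X) {A : Type u} [Finite A] (f : X → A) : Set A :=
  (γ.app (FintypeCat.of A)) (G.map (↾f : X ⟶ A) x)

lemma valueAt_comp {X : Type u} (x : G.obj X) {A B : Type u} [Finite A] [Finite B] (f : X → A)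
    (g : A → B) : valueAt γ x (g ∘ f) = g '' valueAt γ x f := by
  have := ConcreteCategory.congr_hom (γ.naturality (FintypeCat.homMk g : FintypeCat.of A ⟶ .of B))
    (G.map (↾f : X ⟶ A) x)
  rw [valueAt, valueAt]
  refine Eq.trans ?_ this
  change _ = (γ.app (FintypeCat.of B)) (G.map _ (G.map _ x))
  rw [← Functor.map_comp_apply]
  rfl

lemma valueAt_map {X Y : Type u} (g : X ⟶ Y) (x : G.obj X) {A : Type u} [Finite A] (f : Y → A) :
    valueAt γ (G.map g x) f = valueAt γ x (f ∘ g) := by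
  rw [valueAt, valueAt, ← Functor.map_comp_apply]
  rfl

/-- The condition for a set to be in the filter attached to an element of `G X`. -/
def LiftMem {X : Type u} (x : G.obj X) (U : Set X) : Prop :=
  valueAt γ x (fun y => ULift.up.{u} (y ∈ U)) ⊆ {⟨True⟩}

/-- The characteristic map of `f ⁻¹' S` factors through `f`, so membership can be tested on any
finite quotient. -/
lemma liftMem_preimage {X : Type u} (x : G.obj X) {A : Type u} [Finite A] (f : X → A)
    (S : Set A) : LiftMem γ x (f ⁻¹' S) ↔ valueAt γ x f ⊆ S := by
  have := valueAt_comp γ x f (fun y => ULift.up.{u} (y ∈ S))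
  rw [LiftMem]
  change valueAt γ x ((fun y => ULift.up.{u} (y ∈ S)) ∘ f) ⊆ _ ↔ _
  rw [this, image_subset_iff]
  refine iff_of_eq (congrArg _ ?_)
  ext y
  simp [ULift.ext_iff]

/-- The filter attached to an element of `G X`. -/
def liftFilter {X : Type u} (x : G.obj X) : Filter X where
  sets := {U | LiftMem γ x U}
  univ_sets := (liftMem_preimage γ x (fun _ => PUnit.unit.{u+1}) univ).2 (subset_univ _)
  sets_of_superset {U V} hU hUV := by
    -- One finite quotient sees both sets, and the filter axiom becomes a statement about subsets of
    -- it.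
    let f : X → ULift.{u} Prop × ULift.{u} Prop := fun y => (⟨y ∈ U⟩, ⟨y ∈ V⟩)
    have h1 : U = f ⁻¹' {p | p.1.down ∧ p.2.down} := by
      ext y; exact ⟨fun h => ⟨h, hUV h⟩, fun h => h.1⟩
    have h2 : V = f ⁻¹' {p | p.2.down} := rfl
    change LiftMem γ x U at hU
    change LiftMem γ x V
    rw [h1, liftMem_preimage] at hU
    rw [h2, liftMem_preimage]
    exact hU.trans fun p hp => hp.2
  inter_sets {U V} hU hV := by
    let f : X → ULift.{u} Prop × ULift.{u} Prop := fun y => (⟨y ∈ U⟩, ⟨y ∈ V⟩)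
    have h1 : U = f ⁻¹' {p | p.1.down} := rfl
    have h2 : V = f ⁻¹' {p | p.2.down} := rfl
    change LiftMem γ x U at hU
    change LiftMem γ x V at hV
    change LiftMem γ x (U ∩ V)
    rw [h1, liftMem_preimage] at hU
    rw [h2, liftMem_preimage] at hV
    rw [h1, h2, ← preimage_inter, liftMem_preimage]
    exact subset_inter hU hV

lemma preimage_mem_liftFilter {X : Type u} (x : G.obj X) {A : Type u} [Finite A] (f : X → A)
    (S : Set A) : f ⁻¹' S ∈ liftFilter γ x ↔ valueAt γ x f ⊆ S :=
  liftMem_preimage γ x f S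

/-- The transformation to the filter functor induced by a transformation to the powerset functor
on finite sets. -/
def filterLift : G ⟶ filterMonad.{u}.toFunctor where
  app X := ↾(fun x : G.obj X => liftFilter γ x)
  naturality X Y f := by
    ext (x : G.obj X)
    refine Filter.ext fun U : Set Y => ?_
    change LiftMem γ (G.map f x) U ↔ LiftMem γ x (f ⁻¹' U)
    rw [LiftMem, valueAt_map]
    rfl

lemma filterLift_fac :
    Functor.whiskerLeft FintypeCat.incl.{u} (filterLift γ) ≫ filterCounit = γ := by
  ext A (x : G.obj A.obj)
  let T : Set A.obj := γ.app A x
  change (liftFilter γ x).ker = T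
  have (S : Set A.obj) : (liftFilter γ x).ker ⊆ S ↔ T ⊆ S := by
    rw [← mem_iff_ker_subset]
    refine (preimage_mem_liftFilter γ x (id : A.obj → A.obj) S).trans
      (iff_of_eq (congrArg (· ⊆ S) ?_))
    change γ.app A (G.map (𝟙 _) x) = T
    rw [G.map_id]
    rfl
  exact subset_antisymm ((this _).2 Subset.rfl) ((this _).1 Subset.rfl)

/-- Pushing a filter forward along the characteristic map of `U` decides whether `U` belongs to it,
and there the counit loses nothing. -/
lemma eq_filterLift (δ : G ⟶ filterMonad.{u}.toFunctor)
    (hδ : Functor.whiskerLeft FintypeCat.incl.{u} δ ≫ filterCounit = γ) : δ = filterLift γ := by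
  ext X (x : G.obj X)
  refine Filter.ext fun U : Set X => ?_
  subst hδ
  let F : Filter X := δ.app X x
  let f : X ⟶ ULift.{u} Prop := ↾fun y => ULift.up.{u} (y ∈ U)
  let F' : Filter (ULift.{u} Prop) := δ.app (ULift.{u} Prop) (G.map f x)
  have h1 : F' = F.map f := ConcreteCategory.congr_hom (δ.naturality f) x
  change U ∈ F ↔ F'.ker ⊆ {⟨True⟩}
  rw [← mem_iff_ker_subset, h1, mem_map]
  refine iff_of_eq (congrArg (· ∈ F) ?_)
  ext y
  simp [f, ULift.ext_iff]

end Lift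

instance isRightKanExtension_filterMonad :
    filterMonad.{u}.toFunctor.IsRightKanExtension filterCounit.{u} where
  nonempty_isUniversal := ⟨Limits.IsTerminal.ofUniqueHom
    (fun E => CostructuredArrow.homMk (filterLift E.hom) (filterLift_fac E.hom))
    fun E m => CostructuredArrow.hom_ext _ _ (eq_filterLift E.hom _ (CostructuredArrow.w m))⟩

lemma filterCounit_unit (A : FintypeCat.{u}) :
    filterMonad.{u}.η.app A.obj ≫ filterCounit.app A =
      FintypeCat.incl.map (finPowersetMonad.η.app A) :=
  ConcreteCategory.hom_ext _ _ fun x : A.obj => Filter.ker_pure x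

lemma filterCounit_mul (A : FintypeCat.{u}) :
    filterMonad.{u}.μ.app A.obj ≫ filterCounit.app A =
      filterMonad.map (filterCounit.app A) ≫ filterCounit.app (finPowersetMonad.obj A) ≫
        FintypeCat.incl.map (finPowersetMonad.μ.app A) :=
  ConcreteCategory.hom_ext _ _ fun F : Filter (Filter A.obj) => by
    change (join F).ker = ⋃₀ (F.map Filter.ker).ker
    -- Two subsets agree once they have the same supersets, which turns kernels into filter
    -- membership.
    have (S : Set A.obj) : (join F).ker ⊆ S ↔ ⋃₀ (F.map Filter.ker).ker ⊆ S := by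
      rw [← mem_iff_ker_subset, mem_join, sUnion_subset_iff]
      change _ ↔ (F.map Filter.ker).ker ⊆ {T | T ⊆ S}
      rw [← mem_iff_ker_subset, mem_map]
      simp only [mem_iff_ker_subset]
      rfl
    exact subset_antisymm ((this _).2 Subset.rfl) ((this _).1 Subset.rfl)

/-- Any pushforward of the powerset monad on finite sets is the filter monad. -/
noncomputable def pushforwardIsoFilterMonad (R : Type u ⥤ Type u)
    (ε : FintypeCat.incl.{u} ⋙ R ⟶ finPowersetMonad.{u}.toFunctor ⋙ FintypeCat.incl.{u})
    [R.IsRightKanExtension ε] :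
    pushforward FintypeCat.incl.{u} finPowersetMonad.{u} R ε ≅ filterMonad.{u} :=
  pushforwardIso _ _ R ε filterMonad.{u} filterCounit filterCounit_unit filterCounit_mul

/-! ### The equivalence with continuous lattices -/

lemma IsFilterAlgebra.isLatticeAlgebra {X : Type u} {a : Filter X → X} (h : IsFilterAlgebra a) :
    @IsLatticeAlgebra X h.completeLattice a :=
  letI := h.completeLattice
  { toIsFilterAlgebra := h
    map_principal := fun _ => rfl }

lemma isFilterAlgebra (A : filterMonad.{u}.Algebra) :
    IsFilterAlgebra (X := A.A) (fun F => A.a F) where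
  map_pure x := ConcreteCategory.congr_hom A.unit x
  map_join F := (ConcreteCategory.congr_hom A.assoc F).symm

/-- The continuous lattice of an algebra of the filter monad. -/
def algebraLattice (A : filterMonad.{u}.Algebra) : ContinuousLat.{u} :=
  letI := (isFilterAlgebra A).completeLattice
  { carrier := A.A
    isContinuous := (isFilterAlgebra A).isLatticeAlgebra.isContinuousLattice }

lemma algebra_eq_limsInf (A : filterMonad.{u}.Algebra) (F : Filter (algebraLattice A).carrier) :
    A.a F = limsInf F :=
  letI := (isFilterAlgebra A).completeLattice
  (isFilterAlgebra A).isLatticeAlgebra.eq_limsInf F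

lemma algebraHom_iff {A B : filterMonad.{u}.Algebra}
    (f : (algebraLattice A).carrier → (algebraLattice B).carrier) :
    filterMonad.map (↾f : A.A ⟶ B.A) ≫ B.a = A.a ≫ (↾f : A.A ⟶ B.A) ↔
      (∀ s, f (sInf s) = sInf (f '' s)) ∧ ScottContinuous f := by
  rw [← map_limsInf_iff]
  constructor
  · intro h F
    rw [← algebra_eq_limsInf, ← algebra_eq_limsInf]
    exact (ConcreteCategory.congr_hom h F).symm
  · intro h
    refine ConcreteCategory.hom_ext _ _ fun F : Filter (algebraLattice A).carrier => ?_
    have := h F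
    rw [← algebra_eq_limsInf, ← algebra_eq_limsInf] at this
    exact this.symm

/-- The functor from algebras of the filter monad to continuous lattices. -/
def algebraToContinuousLat : filterMonad.{u}.Algebra ⥤ ContinuousLat.{u} where
  obj A := algebraLattice A
  map {A B} f :=
    have h := (algebraHom_iff (A := A) (B := B) (fun x => f.f x)).1 f.h
    show DirSupInfHom (algebraLattice A).carrier (algebraLattice B).carrier from
    { toFun := fun x => f.f x
      map_sInf' := h.1
      scottContinuous' := h.2 }

instance : algebraToContinuousLat.{u}.Faithful where
  map_injective {A B f g} h := by
    ext x
    exact congrArg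
      (fun k : DirSupInfHom (algebraLattice A).carrier (algebraLattice B).carrier => k.toFun x) h

instance : algebraToContinuousLat.{u}.Full where
  map_surjective {A B} f :=
    ⟨{ f := ↾(f.toFun)
       h := algebraHom_iff (A := A) (B := B) f.toFun |>.2 ⟨f.map_sInf', f.scottContinuous'⟩ }, rfl⟩

/-- The algebra of the filter monad on a continuous lattice. -/
def limsInfAlgebra (L : ContinuousLat.{u}) : filterMonad.{u}.Algebra where
  A := L.carrier
  a := ↾(fun F : Filter L.carrier => limsInf F)
  unit := ConcreteCategory.hom_ext _ _ fun x : L.carrier =>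
    (isLatticeAlgebra_limsInf L.carrier).map_pure x
  assoc := ConcreteCategory.hom_ext _ _ fun F : Filter (Filter L.carrier) =>
    ((isLatticeAlgebra_limsInf L.carrier).map_join F).symm

/-- The meets of the algebra on a continuous lattice are the original ones. -/
lemma sInf_limsInfAlgebra (L : ContinuousLat.{u}) (s : Set L.carrier) :
    (sInf (α := (algebraLattice (limsInfAlgebra L)).carrier) s : L.carrier) = sInf s :=
  limsInf_principal_eq_sInf s

/-- The lattice of the algebra on a continuous lattice is the original one. -/
def limsInfAlgebraOrderIso (L : ContinuousLat.{u}) :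
    (algebraLattice (limsInfAlgebra L)).carrier ≃o L.carrier where
  toEquiv := Equiv.refl _
  map_rel_iff' {x y} := by
    -- The two orders are compared through binary meets, because meets are what is known to agree.
    rw [← inf_eq_left, ← sInf_pair, ← inf_eq_left (a := x), ← sInf_pair]
    exact Eq.congr_left (sInf_limsInfAlgebra L {x, y}).symm

/-- An order isomorphism is a morphism of continuous lattices. -/
def homOfOrderIso {L M : ContinuousLat.{u}} (e : L.carrier ≃o M.carrier) : L ⟶ M :=
  show DirSupInfHom L.carrier M.carrier from
  { toFun := e
    map_sInf' := fun s => by rw [e.map_sInf, sInf_image]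
    scottContinuous' := fun _ _ _ _ h => e.isLUB_image'.2 h }

/-- Order-isomorphic continuous lattices are isomorphic. -/
def isoOfOrderIso {L M : ContinuousLat.{u}} (e : L.carrier ≃o M.carrier) : L ≅ M where
  hom := homOfOrderIso e
  inv := homOfOrderIso e.symm
  hom_inv_id := DFunLike.ext (F := DirSupInfHom _ _) _ _ e.symm_apply_apply
  inv_hom_id := DFunLike.ext (F := DirSupInfHom _ _) _ _ e.apply_symm_apply

instance : algebraToContinuousLat.{u}.EssSurj where
  mem_essImage L := ⟨limsInfAlgebra L, ⟨isoOfOrderIso (limsInfAlgebraOrderIso L)⟩⟩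

instance : algebraToContinuousLat.{u}.IsEquivalence where

end PushforwardMonad

theorem mainTheorem5 :
    (FintypeCat.incl.{u}).HasRightKanExtension
        (PushforwardMonad.finPowersetMonad.{u}.toFunctor ⋙ FintypeCat.incl.{u}) ∧
      ∀ (R : Type u ⥤ Type u)
        (ε : FintypeCat.incl.{u} ⋙ R ⟶
          PushforwardMonad.finPowersetMonad.{u}.toFunctor ⋙ FintypeCat.incl.{u})
        [R.IsRightKanExtension ε],
        ∃ e : (PushforwardMonad.pushforward FintypeCat.incl.{u}
              PushforwardMonad.finPowersetMonad.{u} R ε).Algebra ≌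
            PushforwardMonad.ContinuousLat.{u},
          Nonempty (e.functor ⋙ forget PushforwardMonad.ContinuousLat.{u} ≅
            (PushforwardMonad.pushforward FintypeCat.incl.{u}
              PushforwardMonad.finPowersetMonad.{u} R ε).forget) := by
  refine ⟨Functor.HasRightKanExtension.mk PushforwardMonad.filterMonad.{u}.toFunctor
    PushforwardMonad.filterCounit, fun R ε _ => ?_⟩
  refine ⟨(Monad.algebraEquivOfIsoMonads
    (PushforwardMonad.pushforwardIsoFilterMonad R ε)).trans
      PushforwardMonad.algebraToContinuousLat.asEquivalence, ⟨?_⟩⟩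
  -- Every functor involved keeps the underlying set and function.
  exact NatIso.ofComponents (fun A => Iso.refl A.A) fun f => rfl
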